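/- For a finite group $G$ let $\mathrm{Irr}(G)$ be the set of irreducible complex characters of $G$ and $\mathrm{cd}(G)=\{\chi(1) : \chi\in\mathrm{Irr}(G)\}$. Let $\mathcal{D}(G)$ be the simplicial complex whose vertices are the primes dividing at least one member of $\mathrm{cd}(G)$, and in which a nonempty set $Q$ of vertices is a simplex if and only if some element of $\mathrm{cd}(G)$ is divisible by every prime in $Q$; its connectedness and its fundamental group $\pi_1(\mathcal{D}(G))$ are those of its geometric realization. Suppose $G$ is a finite group and $K\lhd G$ is maximal among the normal subgroups $N$ of $G$ for which $G/N$ is nonabelian. If $G/K$ is a $p$-group for some prime $p$, then $\mathcal{D}(G)$ is connected and $\pi_1(\mathcal{D}(G))$ is trivial (for every base point). In particular, if $G$ is a finite nonabelian nilpotent group, then $\mathcal{D}(G)$ is connected and $\pi_1(\mathcal{D}(G))$ is trivial. -/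

import Mathlib

/-- `Irr(G)`: the set of characters of the irreducible complex representations of `G`.
Every finite-dimensional complex representation is isomorphic to one on some `ℂⁿ`, and
isomorphic representations have the same character. -/
def irreducibleCharacters (G : Type*) [Group G] : Set (G → ℂ) :=
  {χ | ∃ (n : ℕ) (ρ : Representation ℂ G (Fin n → ℂ)), ρ.IsIrreducible ∧ ρ.character = χ}

/-- `cd(G) = {χ(1) : χ ∈ Irr(G)}`, the set of irreducible character degrees of `G`. -/
def characterDegrees (G : Type*) [Group G] : Set ℕ :=
  {d | ∃ χ ∈ irreducibleCharacters G, χ 1 = (d : ℂ)}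

/-- The set of primes dividing at least one member of `X \ {1}`. -/
def primeDivisors (X : Set ℕ) : Set ℕ :=
  {p | p.Prime ∧ ∃ v ∈ X \ {1}, p ∣ v}

/-- The prime divisor simplicial complex `𝒟(X)` of a set `X` of positive integers: the vertices
are the primes dividing some member of `X \ {1}`, and a nonempty finite set `Q` of vertices is a
simplex when some `v ∈ X` is divisible by every element of `Q`. -/
def primeDivisorComplex (X : Set ℕ) : AbstractSimplicialComplex (primeDivisors X) where
  faces := {Q | Q.Nonempty ∧ ∃ v ∈ X, ∀ q ∈ Q, (q : ℕ) ∣ v}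
  isRelLowerSet_faces := by
    rintro Q ⟨hQ, v, hv, h⟩
    exact ⟨hQ, fun R hRQ hR => ⟨hR, v, hv, fun q hq => h q (hRQ hq)⟩⟩
  singleton_mem := by
    rintro ⟨p, hp, v, hv, hpv⟩
    exact ⟨Finset.singleton_nonempty _, v, hv.1, by simpa using hpv⟩

/-- The geometric realization of a simplicial complex with (finite) vertex set `ι`, as a subspace
of `ℝ^ι`: the vertex `i` is placed at the standard basis vector `e_i`, and the realization is the
union, over all simplices, of the convex hulls of their vertices. -/
def AbstractSimplicialComplex.realization {ι : Type*} [DecidableEq ι]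
    (K : AbstractSimplicialComplex ι) : Set (ι → ℝ) :=
  ⋃ s ∈ K.faces, convexHull ℝ ((fun i : ι => (Pi.single i 1 : ι → ℝ)) '' (s : Set ι))

/-- The space `𝒟(G)`: the realization of the prime divisor simplicial complex of `cd(G)`. -/
abbrev PrimeDivisorSpace (G : Type*) [Group G] : Type :=
  (primeDivisorComplex (characterDegrees G)).realization

/-- `N` is a normal subgroup of `G` such that `G ⧸ N` is nonabelian. -/
def HasNonabelianQuotient {G : Type*} [Group G] (N : Subgroup G) : Prop :=
  ∃ _ : N.Normal, ∃ a b : G ⧸ N, a * b ≠ b * a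

open scoped TensorProduct MonoidAlgebra

/-! In both statements `G` maps onto a nonabelian `p`-group `P` with kernel `N`; in the nilpotent
case `P` is a Sylow subgroup. It is enough that every degree `d` divides a degree divisible by `p`:
then the complex is a cone with apex `p`, so its realization is contractible. If `p ∤ d`, a
representation `ρ` of degree `d` stays irreducible on `N` (`HasScalarCommutant.ker_of_isPGroup`). An
irreducible `ψ` of `P` of degree `m ≠ 1` has `p ∣ m`, and `ρ ⊗ ψ` is irreducible of degree `d * m`
(`HasScalarCommutant.tprod`). Commutants take the place of Clifford theory. -/

/-- The commutant of `ρ` consists of scalars. For finite groups this characterizes irreducibility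
of nonzero representations. -/
def HasScalarCommutant {G V : Type*} [Monoid G] [AddCommGroup V] [Module ℂ V]
    (ρ : Representation ℂ G V) : Prop :=
  ∀ f : Module.End ℂ V, (∀ g, Commute (ρ g) f) → ∃ c : ℂ, f = c • 1

/-! ### Irreducibility and scalar commutants -/

theorem Representation.IsIrreducible.hasScalarCommutant {G V : Type*} [Group G] [AddCommGroup V]
    [Module ℂ V] [FiniteDimensional ℂ V] {ρ : Representation ℂ G V} (hρ : ρ.IsIrreducible) :
    HasScalarCommutant ρ := by
  intro f hf
  let F : Representation.IntertwiningMap ρ ρ := ⟨f, fun g => (hf g).eq.symm⟩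
  obtain ⟨c, hc⟩ :=
    (Representation.IsIrreducible.algebraMap_intertwiningMap_bijective_of_isAlgClosed
      (ρ := ρ)).2 F
  refine ⟨c, ?_⟩
  have := congrArg Representation.IntertwiningMap.toLinearMap hc
  exact this.symm

theorem Representation.IsIrreducible.nontrivial {G V : Type*} [Group G] [AddCommGroup V]
    [Module ℂ V] {ρ : Representation ℂ G V} (hρ : ρ.IsIrreducible) : Nontrivial V := by
  by_contra h
  rw [not_nontrivial_iff_subsingleton] at h
  obtain ⟨a, b, hab⟩ := hρ.toNontrivial
  exact hab (Subrepresentation.toSubmodule_injective (Subsingleton.elim _ _))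

/-- By Maschke, an invariant subspace has an invariant complement; the projection along it lies in
the commutant, so it is a scalar. -/
theorem HasScalarCommutant.isIrreducible {G V : Type*} [Group G] [Finite G] [AddCommGroup V]
    [Module ℂ V] [Nontrivial V] {ρ : Representation ℂ G V} (h : HasScalarCommutant ρ) :
    ρ.IsIrreducible := by
  have : Nontrivial (Subrepresentation ρ) := by
    refine ⟨⊥, ⊤, fun h => ?_⟩
    have := congrArg Subrepresentation.toSubmodule h
    exact bot_ne_top (α := Submodule ℂ V) this
  have hss : Representation.IsSemisimpleRepresentation ρ := by
    have : NeZero (Nat.card G : ℂ) := ⟨Nat.cast_ne_zero.mpr Nat.card_pos.ne'⟩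
    infer_instance
  refine ⟨fun A => ?_⟩
  obtain ⟨B, hAB⟩ := hss.exists_isCompl A
  have hc : IsCompl A.toSubmodule B.toSubmodule := by
    constructor
    · rw [disjoint_iff]
      exact congrArg Subrepresentation.toSubmodule (disjoint_iff.mp hAB.1)
    · rw [codisjoint_iff]
      exact congrArg Subrepresentation.toSubmodule (codisjoint_iff.mp hAB.2)
  let π := A.toSubmodule.projection B.toSubmodule hc
  have hπA : ∀ a ∈ A.toSubmodule, π a = a := fun a ha =>
    Submodule.projection_apply_left hc ⟨a, ha⟩
  have hπB : ∀ b ∈ B.toSubmodule, π b = 0 := fun b hb =>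
    (Submodule.projection_apply_eq_zero_iff hc).mpr hb
  have hcomm : ∀ g, Commute (ρ g) π := by
    intro g
    refine LinearMap.ext fun v => ?_
    obtain ⟨a, ha, b, hb, rfl⟩ := Submodule.mem_sup.mp (hc.sup_eq_top ▸ Submodule.mem_top (x := v))
    simp only [Module.End.mul_apply, map_add, hπA _ ha, hπB _ hb,
      hπA _ (A.apply_mem_toSubmodule g ha), hπB _ (B.apply_mem_toSubmodule g hb), map_zero]
  obtain ⟨c, hcf⟩ := h _ hcomm
  by_cases h0 : c = 0
  · left
    apply Subrepresentation.toSubmodule_injective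
    refine (Submodule.eq_bot_iff _).mpr fun v hv => ?_
    rw [← hπA v hv, hcf, h0, zero_smul, LinearMap.zero_apply]
  · right
    apply Subrepresentation.toSubmodule_injective
    refine Submodule.eq_top_iff'.mpr fun v => ?_
    have : π v ∈ A.toSubmodule := Submodule.projection_apply_mem hc v
    rw [hcf] at this
    exact (Submodule.smul_mem_iff _ h0).mp this

theorem HasScalarCommutant.finrank_mem_characterDegrees {G V : Type*} [Group G] [Finite G]
    [AddCommGroup V] [Module ℂ V] [Nontrivial V] [FiniteDimensional ℂ V]
    {ρ : Representation ℂ G V} (h : HasScalarCommutant ρ) :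
    Module.finrank ℂ V ∈ characterDegrees G := by
  let e : V ≃ₗ[ℂ] (Fin (Module.finrank ℂ V) → ℂ) := (Module.finBasis ℂ V).equivFun
  let c : Module.End ℂ V ≃* Module.End ℂ (Fin (Module.finrank ℂ V) → ℂ) :=
    (e.conjAlgEquiv ℂ).toMulEquiv
  let σ : Representation ℂ G (Fin (Module.finrank ℂ V) → ℂ) := c.toMonoidHom.comp ρ
  have hσ : HasScalarCommutant σ := by
    intro f hf
    obtain ⟨a, ha⟩ := h (c.symm f) fun g => by
      have := (hf g).map c.symm
      simpa [σ] using this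
    refine ⟨a, ?_⟩
    rw [MulEquiv.symm_apply_eq] at ha
    rw [ha]
    exact (map_smul (e.conjAlgEquiv ℂ) a 1).trans (by rw [map_one])
  have : Nontrivial (Fin (Module.finrank ℂ V) → ℂ) := e.symm.toEquiv.nontrivial
  refine ⟨_, ⟨_, σ, hσ.isIrreducible, rfl⟩, ?_⟩
  rw [Representation.char_one, Module.finrank_fin_fun]

theorem exists_hasScalarCommutant_of_mem_characterDegrees {G : Type*} [Group G] {d : ℕ}
    (hd : d ∈ characterDegrees G) :
    ∃ ρ : Representation ℂ G (Fin d → ℂ), HasScalarCommutant ρ ∧ Nontrivial (Fin d → ℂ) := by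
  obtain ⟨_, ⟨n, ρ, hρ, rfl⟩, h⟩ := hd
  rw [Representation.char_one, Module.finrank_fin_fun, Nat.cast_inj] at h
  subst h
  exact ⟨ρ, hρ.hasScalarCommutant, hρ.nontrivial⟩

/-! ### Nonlinear characters and restriction to normal subgroups -/

theorem exists_eigenvector_ne_one_of_pow_eq_one {E : Type*} [AddCommGroup E] [Module ℂ E]
    [FiniteDimensional ℂ E] {C : Module.End ℂ E} {m : ℕ} (hm : m ≠ 0) (hC : C ^ m = 1)
    (h1 : C ≠ 1) : ∃ μ : ℂ, μ ≠ 1 ∧ ∃ y, y ≠ 0 ∧ C y = μ • y := by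
  let R := LinearMap.range (C - 1)
  have hR : ∀ x ∈ R, C x ∈ R := by
    rintro _ ⟨x, rfl⟩
    exact ⟨C x, by simp⟩
  have : Nontrivial R := by
    rw [Submodule.nontrivial_iff_ne_bot]
    intro h
    exact h1 (sub_eq_zero.mp (LinearMap.range_eq_bot.mp h))
  obtain ⟨μ, hμ⟩ := Module.End.exists_eigenvalue (C.restrict hR)
  obtain ⟨⟨y, x, rfl⟩, hy⟩ := hμ.exists_hasEigenvector
  have hne : (C - 1) x ≠ 0 := fun h => hy.2 (Subtype.ext h)
  have hev : C ((C - 1) x) = μ • (C - 1) x := congrArg Subtype.val hy.apply_eq_smul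
  refine ⟨μ, ?_, _, hne, hev⟩
  -- An eigenvalue 1 on the range of `C - 1` would give a Jordan block, whose powers grow linearly,
  -- against `C ^ m = 1`.
  rintro rfl
  rw [one_smul] at hev
  have key : ∀ k : ℕ, (C ^ k) x = x + (k : ℂ) • (C - 1) x := by
    intro k
    induction k with
    | zero => simp
    | succ k ih =>
      rw [pow_succ', Module.End.mul_apply, ih, map_add, map_smul, hev]
      push_cast
      rw [add_smul, one_smul]
      simp only [LinearMap.sub_apply, Module.End.one_apply]
      abel
  have := key m
  rw [hC, Module.End.one_apply, left_eq_add, smul_eq_zero] at this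
  exact this.elim (by exact_mod_cast hm) hne

/-- If all degrees were 1, `a * b` and `b * a` would act alike on every simple left ideal, hence on
the semisimple ring `ℂ[P]`. -/
theorem exists_mem_characterDegrees_ne_one {P : Type*} [Group P] [Finite P] {a b : P}
    (hab : a * b ≠ b * a) : ∃ d ∈ characterDegrees P, d ≠ 1 := by
  by_contra! hall
  have : NeZero (Nat.card P : ℂ) := ⟨Nat.cast_ne_zero.mpr Nat.card_pos.ne'⟩
  have key : ∀ x : ℂ[P], MonoidAlgebra.of ℂ P (a * b) • x = MonoidAlgebra.of ℂ P (b * a) • x := by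
    intro x
    have hx : x ∈ sSup {m : Submodule ℂ[P] ℂ[P] | IsSimpleModule ℂ[P] m} := by
      rw [IsSemisimpleModule.sSup_simples_eq_top]; trivial
    rw [sSup_eq_iSup'] at hx
    induction hx using Submodule.iSup_induction' with
    | mem S x hx =>
      obtain ⟨S, hS⟩ := S
      have hS : IsSimpleModule ℂ[P] S := hS
      have : Nontrivial S := IsSimpleModule.nontrivial ℂ[P] S
      have hfin : FiniteDimensional ℂ S := Module.Finite.trans ℂ[P] _
      let ρ : Representation ℂ P S := Representation.ofModule' S
      have hsc : HasScalarCommutant ρ := fun f hf => by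
        let F : S →ₗ[ℂ[P]] S := MonoidAlgebra.equivariantOfLinearOfComm f fun g v =>
          (LinearMap.congr_fun (hf g).eq v).symm
        obtain ⟨c, hc⟩ := (IsSimpleModule.algebraMap_end_bijective_of_isAlgClosed
          (A := ℂ[P]) (V := S) ℂ).2 F
        exact ⟨c, LinearMap.ext fun v => (LinearMap.congr_fun hc v).symm⟩
      obtain ⟨v, -, hv⟩ := finrank_eq_one_iff'.mp (hall _ hsc.finrank_mem_characterDegrees)
      have hcomm : ρ (a * b) = ρ (b * a) := by
        obtain ⟨α, hα⟩ := hv (ρ a v)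
        obtain ⟨β, hβ⟩ := hv (ρ b v)
        refine LinearMap.ext fun w => ?_
        obtain ⟨c, rfl⟩ := hv w
        rw [map_smul, map_smul, map_mul, map_mul, Module.End.mul_apply, Module.End.mul_apply, ← hα,
          ← hβ, map_smul, map_smul, ← hα, ← hβ, smul_smul α, smul_smul β, mul_comm α]
      exact congrArg Subtype.val (LinearMap.congr_fun hcomm (⟨x, hx⟩ : S))
    | zero => simp
    | add x y _ _ hx hy => rw [smul_add, smul_add, hx, hy]
  have := key 1
  rw [smul_eq_mul, smul_eq_mul, mul_one, mul_one] at this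
  exact hab (MonoidAlgebra.of_injective this)

/-- Conjugation by `g` acts on the commutant of `M` with order dividing `p ^ k`. An eigenvector `y`
with eigenvalue `μ ≠ 1` has kernel invariant under `M` and `g`, so it is invertible; determinants
give `μ ^ dim V = 1`, impossible since `p ∤ dim V`. So `g` centralizes the commutant of `M`. -/
theorem HasScalarCommutant.of_sup_zpowers {G V : Type*} [Group G] [Finite G] [AddCommGroup V]
    [Module ℂ V] [Nontrivial V] [FiniteDimensional ℂ V] {ρ : Representation ℂ G V} {p k : ℕ}
    (hp : p.Prime) (hdim : ¬ p ∣ Module.finrank ℂ V) {M : Subgroup G} {g : G}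
    (hg : ∀ x ∈ M, g⁻¹ * x * g ∈ M) (hgp : g ^ p ^ k ∈ M)
    (h : HasScalarCommutant (ρ.comp (M ⊔ Subgroup.zpowers g).subtype)) :
    HasScalarCommutant (ρ.comp M.subtype) := by
  have hirr := h.isIrreducible
  have hgg' : ρ g * ρ g⁻¹ = 1 := by rw [← map_mul]; simp
  have hgg1 : ρ g⁻¹ * ρ g = 1 := by rw [← map_mul]; simp
  -- the commutant of `M`, on which `g` acts by conjugation
  let S : Submodule ℂ (Module.End ℂ V) :=
    { carrier := {f | ∀ x ∈ M, Commute (ρ x) f}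
      add_mem' := fun ha hb x hx => (ha x hx).add_right (hb x hx)
      zero_mem' := fun x _ => Commute.zero_right _
      smul_mem' := fun c f hf x hx => (hf x hx).smul_right c }
  let C₀ : Module.End ℂ (Module.End ℂ V) :=
    LinearMap.mulLeft ℂ (ρ g) ∘ₗ LinearMap.mulRight ℂ (ρ g⁻¹)
  have hC₀ : ∀ f, C₀ f = ρ g * f * ρ g⁻¹ := fun f => by simp [C₀, mul_assoc]
  have hS : ∀ f ∈ S, C₀ f ∈ S := by
    intro f hf x hx
    have h1 := (hf _ (hg x hx)).eq
    rw [map_mul, map_mul] at h1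
    rw [hC₀]
    change ρ x * (ρ g * f * ρ g⁻¹) = ρ g * f * ρ g⁻¹ * ρ x
    calc ρ x * (ρ g * f * ρ g⁻¹) = (ρ g * ρ g⁻¹) * ρ x * ρ g * f * ρ g⁻¹ := by
          rw [hgg', one_mul]; simp only [mul_assoc]
      _ = ρ g * (ρ g⁻¹ * ρ x * ρ g * f) * ρ g⁻¹ := by simp only [mul_assoc]
      _ = ρ g * f * ρ g⁻¹ * ρ x * (ρ g * ρ g⁻¹) := by rw [h1]; simp only [mul_assoc]
      _ = _ := by rw [hgg', mul_one]
  let C : Module.End ℂ S := C₀.restrict hS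
  have hCpow : ∀ (n : ℕ) (f : S), ((C ^ n) f : Module.End ℂ V) = ρ (g ^ n) * f * ρ (g⁻¹ ^ n) := by
    intro n f
    induction n with
    | zero => simp
    | succ n ih =>
      rw [pow_succ', Module.End.mul_apply]
      change C₀ ((C ^ n) f : Module.End ℂ V) = _
      rw [hC₀, ih, pow_succ', pow_succ g⁻¹, map_mul, map_mul]
      simp only [mul_assoc]
  have hC1 : C ^ p ^ k = 1 := by
    refine LinearMap.ext fun f => Subtype.ext ?_
    rw [hCpow, (f.2 _ hgp).eq, mul_assoc, ← map_mul]
    simp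
  have hC : C = 1 := by
    by_contra hne
    obtain ⟨μ, hμ1, ⟨y, hyS⟩, hy0, hy⟩ :=
      exists_eigenvector_ne_one_of_pow_eq_one (pow_ne_zero k hp.ne_zero) hC1 hne
    have hy0 : y ≠ 0 := fun h => hy0 (Subtype.ext h)
    have hev : ρ g * y * ρ g⁻¹ = μ • y := (hC₀ y).symm.trans (congrArg Subtype.val hy)
    have hev' : ρ g * y = μ • (y * ρ g) := by
      rw [← smul_mul_assoc, ← hev, mul_assoc, hgg1, mul_one]
    have hμp : μ ^ p ^ k = 1 := by
      have : ∀ n : ℕ, (C ^ n) ⟨y, hyS⟩ = μ ^ n • (⟨y, hyS⟩ : S) := by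
        intro n
        induction n with
        | zero => simp
        | succ n ih => rw [pow_succ', Module.End.mul_apply, ih, map_smul, hy, smul_smul, pow_succ]
      have h2 := congrArg Subtype.val (this (p ^ k))
      rw [hC1] at h2
      by_contra hc
      apply hy0
      have : (μ ^ p ^ k - 1) • y = 0 := by rw [sub_smul, one_smul]; exact sub_eq_zero.mpr h2.symm
      exact (smul_eq_zero.mp this).resolve_left (sub_ne_zero.mpr hc)
    have hμ0 : μ ≠ 0 := by
      rintro rfl
      rw [zero_pow (pow_ne_zero k hp.ne_zero)] at hμp
      exact zero_ne_one hμp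
    have hker : ∀ x ∈ M ⊔ Subgroup.zpowers g, ∀ v, y v = 0 ↔ y (ρ x v) = 0 := by
      let H : Subgroup G :=
        { carrier := {x | ∀ v, y v = 0 ↔ y (ρ x v) = 0}
          one_mem' := fun v => by simp
          mul_mem' := fun ha hb v => by rw [map_mul, hb v, ha]; rfl
          inv_mem' := fun {x} ha v => by rw [ha (ρ x⁻¹ v), Representation.self_inv_apply] }
      suffices M ⊔ Subgroup.zpowers g ≤ H from this
      refine sup_le (fun x hx v => ?_) (Subgroup.zpowers_le.mpr fun v => ?_)
      · have := LinearMap.congr_fun (hyS x hx).eq v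
        rw [Module.End.mul_apply, Module.End.mul_apply] at this
        rw [← this, LinearMap.map_eq_zero_iff _ (ρ.apply_bijective x).1]
      · have := LinearMap.congr_fun hev' v
        rw [Module.End.mul_apply, LinearMap.smul_apply, Module.End.mul_apply] at this
        rw [← LinearMap.map_eq_zero_iff _ (ρ.apply_bijective g).1, this, smul_eq_zero,
          or_iff_right hμ0]
    have hinj : LinearMap.ker y = ⊥ := by
      let K : Subrepresentation (ρ.comp (M ⊔ Subgroup.zpowers g).subtype) :=
        ⟨LinearMap.ker y, fun x v hv => (hker x x.2 v).mp hv⟩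
      rcases hirr.eq_bot_or_eq_top K with hK | hK
      · exact congrArg Subrepresentation.toSubmodule hK
      · exact absurd (LinearMap.ker_eq_top.mp (congrArg Subrepresentation.toSubmodule hK)) hy0
    have hdet : LinearMap.det y ≠ 0 :=
      ((LinearMap.isUnit_iff_ker_eq_bot y).mpr hinj |>.map LinearMap.det).ne_zero
    have hμn : μ ^ Module.finrank ℂ V = 1 := by
      have := congrArg LinearMap.det hev
      rw [map_mul, map_mul, LinearMap.det_smul, mul_right_comm, ← map_mul, hgg', map_one,
        one_mul] at this
      exact (mul_eq_right₀ hdet).mp this.symm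
    have hcop : Nat.Coprime (p ^ k) (Module.finrank ℂ V) :=
      ((Nat.Prime.coprime_iff_not_dvd hp).mpr hdim).pow_left k
    exact hμ1 (by simpa [hcop.gcd_eq_one] using pow_gcd_eq_one.mpr ⟨hμp, hμn⟩)
  intro f hf
  have hfS : f ∈ S := fun x hx => hf ⟨x, hx⟩
  have hfg : Commute (ρ g) f := by
    have h1 : ρ g * f * ρ g⁻¹ = f := (hC₀ f).symm.trans
      (congrArg Subtype.val (LinearMap.congr_fun hC ⟨f, hfS⟩))
    change ρ g * f = f * ρ g
    conv_rhs => rw [← h1, mul_assoc, hgg1, mul_one]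
  let H : Subgroup G :=
    { carrier := {x | Commute (ρ x) f}
      one_mem' := by simp
      mul_mem' := fun ha hb => by
        change Commute _ _
        rw [map_mul]
        exact ha.mul_left hb
      inv_mem' := fun {x} ha => by
        have h1 : ρ x * ρ x⁻¹ = 1 := by rw [← map_mul]; simp
        have h2 : ρ x⁻¹ * ρ x = 1 := by rw [← map_mul]; simp
        exact Commute.units_inv_left (u := ⟨ρ x, ρ x⁻¹, h1, h2⟩) ha }
  have hH : M ⊔ Subgroup.zpowers g ≤ H := sup_le hfS (Subgroup.zpowers_le.mpr hfg)
  exact h f fun x => hH x.2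

/-- Take a maximal counterexample `M` above the kernel. Normalizers grow in `P`, so some `g ∉ M`
normalizes `M`, and `M ⊔ ⟨g⟩` has scalar commutant by maximality. -/
theorem HasScalarCommutant.ker_of_isPGroup {G P V : Type*} [Group G] [Finite G] [Group P]
    [Finite P] [AddCommGroup V] [Module ℂ V] [Nontrivial V] [FiniteDimensional ℂ V]
    {ρ : Representation ℂ G V} {p : ℕ} (hp : p.Prime) (hP : IsPGroup p P) {π : G →* P}
    (hπ : Function.Surjective π)
    (hdim : ¬ p ∣ Module.finrank ℂ V) (h : HasScalarCommutant ρ) :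
    HasScalarCommutant (ρ.comp π.ker.subtype) := by
  have : Fact p.Prime := ⟨hp⟩
  by_contra hN
  obtain ⟨M, hM, hmax⟩ := (Set.toFinite {M : Subgroup G | π.ker ≤ M ∧
    ¬ HasScalarCommutant (ρ.comp M.subtype)}).exists_maximal ⟨π.ker, le_rfl, hN⟩
  obtain ⟨hNM, hMs⟩ := hM
  have hcm : (M.map π).comap π = M := by rw [Subgroup.comap_map_eq, sup_eq_left.mpr hNM]
  have hMtop : M.map π < ⊤ := lt_top_iff_ne_top.mpr fun h1 => hMs <| by
    rw [h1, Subgroup.comap_top] at hcm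
    intro f hf
    exact h f fun g => hf ⟨g, hcm ▸ Subgroup.mem_top g⟩
  have := hP.isNilpotent
  obtain ⟨-, x, hx, hxM⟩ := SetLike.lt_iff_le_and_exists.mp
    (Group.normalizerCondition_of_isNilpotent _ hMtop)
  obtain ⟨g, rfl⟩ := hπ x
  have hgM : g ∉ M := fun h1 => hxM (Subgroup.mem_map_of_mem π h1)
  have hgn : g ∈ Subgroup.normalizer (M : Set G) := by
    rw [← hcm]
    exact Subgroup.le_normalizer_comap π hx
  obtain ⟨k, hk⟩ := hP (π g)
  refine hMs (HasScalarCommutant.of_sup_zpowers hp hdim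
    (fun x hx => (Subgroup.mem_normalizer_iff''.mp hgn x).mp hx)
    (hNM (show π (g ^ p ^ k) = 1 by rw [map_pow, hk])) ?_)
  by_contra h2
  exact hgM (hmax ⟨hNM.trans le_sup_left, h2⟩ le_sup_left
    (Subgroup.mem_sup_right (Subgroup.mem_zpowers g)))
-- Tensor products and degrees divisible by `p`
theorem HasScalarCommutant.tprod {G V W : Type*} [Group G] [AddCommGroup V] [Module ℂ V]
    [Nontrivial V] [AddCommGroup W] [Module ℂ W] [FiniteDimensional ℂ W]
    {ρ : Representation ℂ G V} {ψ : Representation ℂ G W} {N : Subgroup G}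
    (hρ : HasScalarCommutant (ρ.comp N.subtype)) (hN : ∀ x ∈ N, ψ x = 1)
    (hψ : HasScalarCommutant ψ) : HasScalarCommutant (ρ.tprod ψ) := by
  intro f hf
  let b := Module.finBasis ℂ W
  -- The slices of `f` along `W` commute with `N`, which acts trivially on `W`; hence they are
  -- scalars and `f = 1 ⊗ B`.
  let T (φ : W →ₗ[ℂ] ℂ) (w : W) : Module.End ℂ V :=
    (TensorProduct.rid ℂ V).toLinearMap ∘ₗ φ.lTensor V ∘ₗ f ∘ₗ (TensorProduct.mk ℂ V W).flip w
  have hT : ∀ φ w, ∃ c : ℂ, T φ w = c • 1 := by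
    intro φ w
    refine hρ _ fun x => ?_
    have hx : ∀ z, φ.lTensor V ((ρ x).rTensor W z) = (ρ x).rTensor ℂ (φ.lTensor V z) := fun z => by
      rw [← LinearMap.comp_apply, ← LinearMap.comp_apply, LinearMap.lTensor_comp_rTensor,
        LinearMap.rTensor_comp_lTensor]
    refine LinearMap.ext fun v => ?_
    have h1 := LinearMap.congr_fun (hf x).eq (v ⊗ₜ[ℂ] w)
    rw [Module.End.mul_apply, Module.End.mul_apply, Representation.tprod_apply,
      TensorProduct.map_tmul, hN x x.2, Module.End.one_apply] at h1
    change ρ x (T φ w v) = T φ w (ρ x v)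
    simp only [T, LinearMap.comp_apply, LinearMap.flip_apply, TensorProduct.mk_apply,
      LinearEquiv.coe_coe]
    rw [← h1]
    change _ = (TensorProduct.rid ℂ V) (φ.lTensor V ((ρ x).rTensor W _))
    rw [hx]
    generalize φ.lTensor V _ = z
    induction z using TensorProduct.induction_on with
    | zero => simp
    | tmul v c => simp
    | add a b ha hb => simp only [map_add, ha, hb]
  choose c hc using hT
  let B : Module.End ℂ W := b.constr ℂ fun j => ∑ i, c (b.coord i) (b j) • b i
  have hsum : ∀ z : V ⊗[ℂ] W,
      z = ∑ i, (TensorProduct.rid ℂ V ((b.coord i).lTensor V z)) ⊗ₜ[ℂ] b i := by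
    intro z
    induction z using TensorProduct.induction_on with
    | zero => simp
    | tmul v w =>
      conv_lhs => rw [← b.sum_repr w, TensorProduct.tmul_sum]
      simp [TensorProduct.smul_tmul']
    | add x y hx hy =>
      simp only [map_add, TensorProduct.add_tmul, Finset.sum_add_distrib]
      rw [← hx, ← hy]
  have hfB : f = TensorProduct.map LinearMap.id B := by
    refine TensorProduct.ext' fun v w => ?_
    suffices f ∘ₗ TensorProduct.mk ℂ V W v = TensorProduct.mk ℂ V W v ∘ₗ B from
      LinearMap.congr_fun this w
    refine b.ext fun j => ?_
    rw [LinearMap.comp_apply, hsum (f _), LinearMap.comp_apply, b.constr_basis, map_sum]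
    refine Finset.sum_congr rfl fun i _ => ?_
    have := LinearMap.congr_fun (hc (b.coord i) (b j)) v
    change (TensorProduct.rid ℂ V ((b.coord i).lTensor V (f (v ⊗ₜ b j)))) = _ at this
    rw [TensorProduct.mk_apply, this]
    simp [TensorProduct.smul_tmul']
  obtain ⟨v, hv⟩ := exists_ne (0 : V)
  obtain ⟨φ, hφ⟩ := not_forall.mp (mt (Module.forall_dual_apply_eq_zero_iff ℂ v).mp hv)
  -- Starting from `ρ g⁻¹ v` leaves `v` in the first factor on both sides, and `φ v ≠ 0` can be
  -- cancelled.
  obtain ⟨a, ha⟩ := hψ B fun g => by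
    refine LinearMap.ext fun w => ?_
    have h1 := LinearMap.congr_fun (hf g).eq (ρ g⁻¹ v ⊗ₜ[ℂ] w)
    rw [hfB] at h1
    simp only [Module.End.mul_apply, Representation.tprod_apply, TensorProduct.map_tmul,
      LinearMap.id_apply, Representation.self_inv_apply] at h1
    have h2 := congrArg (fun z => TensorProduct.lid ℂ W (φ.rTensor W z)) h1
    simpa [hφ] using h2
  refine ⟨a, ?_⟩
  rw [hfB, ha, TensorProduct.map_smul_right]
  congr 1
  exact TensorProduct.map_id

/-- Restricting to the kernel of the identity, the trivial group, makes every endomorphism scalar,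
including the rank-one map taking `v` to `w`. -/
theorem HasScalarCommutant.finrank_eq_one_of_isPGroup {P V : Type*} [Group P] [Finite P]
    [AddCommGroup V] [Module ℂ V] [Nontrivial V] [FiniteDimensional ℂ V]
    {ρ : Representation ℂ P V} {p : ℕ} (hp : p.Prime) (hP : IsPGroup p P)
    (hdim : ¬ p ∣ Module.finrank ℂ V) (h : HasScalarCommutant ρ) : Module.finrank ℂ V = 1 := by
  have hs := h.ker_of_isPGroup hp hP (π := MonoidHom.id P) Function.surjective_id hdim
  obtain ⟨v, hv⟩ := exists_ne (0 : V)
  obtain ⟨φ, hφ⟩ := not_forall.mp (mt (Module.forall_dual_apply_eq_zero_iff ℂ v).mp hv)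
  refine (finrank_eq_one_iff_of_nonzero' v hv).mpr fun w => ?_
  obtain ⟨c, hc⟩ := hs ((φ v)⁻¹ • φ.smulRight w) fun ⟨x, hx⟩ => by
    obtain rfl : x = 1 := hx
    change Commute (ρ 1) _
    rw [map_one]
    exact Commute.one_left _
  refine ⟨c, ?_⟩
  have := LinearMap.congr_fun hc v
  rw [LinearMap.smul_apply, LinearMap.smulRight_apply, inv_smul_smul₀ hφ] at this
  exact this.symm

theorem exists_dvd_mem_characterDegrees {G P : Type*} [Group G] [Finite G] [Group P] [Finite P]
    {p : ℕ} (hp : p.Prime) (hP : IsPGroup p P) (hab : ∃ a b : P, a * b ≠ b * a) {π : G →* P}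
    (hπ : Function.Surjective π) {d : ℕ} (hd : d ∈ characterDegrees G) :
    ∃ e ∈ characterDegrees G, d ∣ e ∧ p ∣ e := by
  by_cases hpd : p ∣ d
  · exact ⟨d, hd, dvd_rfl, hpd⟩
  obtain ⟨ρ, hρ, _⟩ := exists_hasScalarCommutant_of_mem_characterDegrees hd
  obtain ⟨a, b, hab⟩ := hab
  obtain ⟨m, hm, hm1⟩ := exists_mem_characterDegrees_ne_one hab
  obtain ⟨ψ, hψ, _⟩ := exists_hasScalarCommutant_of_mem_characterDegrees hm
  have hpm : p ∣ m := by
    by_contra h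
    have := hψ.finrank_eq_one_of_isPGroup hp hP (by rwa [Module.finrank_fin_fun])
    exact hm1 (by rwa [Module.finrank_fin_fun] at this)
  have hψπ : HasScalarCommutant (ψ.comp π) := fun f hf => hψ f fun x => by
    obtain ⟨g, rfl⟩ := hπ x
    exact hf g
  have hker := hρ.ker_of_isPGroup hp hP hπ (by rwa [Module.finrank_fin_fun])
  have ht := hker.tprod (fun x (hx : π x = 1) => by simp [hx]) hψπ
  have : Nontrivial ((Fin d → ℂ) ⊗[ℂ] (Fin m → ℂ)) := by
    rw [← Module.finrank_pos_iff (R := ℂ), Module.finrank_tensorProduct]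
    exact Nat.mul_pos Module.finrank_pos Module.finrank_pos
  refine ⟨d * m, ?_, dvd_mul_right _ _, hpm.mul_left _⟩
  simpa using ht.finrank_mem_characterDegrees

theorem one_mem_characterDegrees (G : Type*) [Group G] [Finite G] : 1 ∈ characterDegrees G := by
  have h : HasScalarCommutant (Representation.trivial ℂ G ℂ) := fun f _ =>
    ⟨f 1, LinearMap.ext_ring (by simp)⟩
  simpa using h.finrank_mem_characterDegrees

/-! ### Cones and the two cases of the theorem -/

theorem AbstractSimplicialComplex.starConvex_realization {ι : Type*} [DecidableEq ι]
    (K : AbstractSimplicialComplex ι) (p : ι) (h : ∀ s ∈ K.faces, insert p s ∈ K.faces) :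
    StarConvex ℝ (Pi.single p 1) K.realization := by
  refine starConvex_iff_segment_subset.mpr fun x hx => ?_
  obtain ⟨s, hs, hxs⟩ := Set.mem_iUnion₂.mp hx
  refine Set.Subset.trans ?_ (Set.subset_iUnion₂ (insert p s) (h s hs))
  exact (convex_convexHull ℝ _).segment_subset (subset_convexHull ℝ _ ⟨p, by simp, rfl⟩)
    (convexHull_mono (Set.image_mono (by simp)) hxs)

/-- The realization of a cone is contractible. -/
theorem AbstractSimplicialComplex.contractibleSpace_realization {ι : Type*} [DecidableEq ι]
    (K : AbstractSimplicialComplex ι) (p : ι) (h : ∀ s ∈ K.faces, insert p s ∈ K.faces) :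
    ContractibleSpace K.realization :=
  (K.starConvex_realization p h).contractibleSpace
    ⟨Pi.single p 1, Set.mem_iUnion₂.mpr
      ⟨{p}, K.singleton_mem p, subset_convexHull ℝ _ ⟨p, by simp, rfl⟩⟩⟩

/-- If `G` maps onto a nonabelian `p`-group, then `𝒟(G)` is a cone with apex `p`. -/
theorem contractibleSpace_primeDivisorSpace {G P : Type*} [Group G] [Finite G] [Group P]
    [Finite P] {p : ℕ} (hp : p.Prime) (hP : IsPGroup p P) (hab : ∃ a b : P, a * b ≠ b * a)
    {π : G →* P} (hπ : Function.Surjective π) : ContractibleSpace (PrimeDivisorSpace G) := by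
  obtain ⟨e, he, -, hpe⟩ :=
    exists_dvd_mem_characterDegrees hp hP hab hπ (one_mem_characterDegrees G)
  have hpv : p ∈ primeDivisors (characterDegrees G) :=
    ⟨hp, e, ⟨he, fun h => hp.one_lt.ne' (Nat.dvd_one.mp (h ▸ hpe))⟩, hpe⟩
  refine AbstractSimplicialComplex.contractibleSpace_realization _ ⟨p, hpv⟩ ?_
  rintro s ⟨-, v, hv, hsv⟩
  obtain ⟨w, hw, hvw, hpw⟩ := exists_dvd_mem_characterDegrees hp hP hab hπ hv
  refine ⟨Finset.insert_nonempty _ _, w, hw, fun q hq => ?_⟩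
  rcases Finset.mem_insert.mp hq with rfl | hq
  · exact hpw
  · exact (hsv q hq).trans hvw

/-- A finite nilpotent group is the product of its Sylow subgroups; project to a factor where `a`
and `b` fail to commute. -/
theorem Group.IsNilpotent.exists_surjective_sylow {G : Type*} [Group G] [Finite G]
    (hG : Group.IsNilpotent G) (h : ∃ a b : G, a * b ≠ b * a) :
    ∃ p : ℕ, p.Prime ∧ ∃ (P : Sylow p G) (π : G →* P), Function.Surjective π ∧
      ∃ a b : P, a * b ≠ b * a := by
  obtain ⟨e⟩ := ((Group.isNilpotent_of_finite_tfae (G := G)).out 0 4).mp hG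
  obtain ⟨a, b, hab⟩ := h
  have : e.symm a * e.symm b ≠ e.symm b * e.symm a := by
    rw [← map_mul, ← map_mul]
    exact fun h => hab (e.symm.injective h)
  obtain ⟨p, hp⟩ := Function.ne_iff.mp this
  obtain ⟨P, hP⟩ := Function.ne_iff.mp hp
  classical
  refine ⟨p, Nat.prime_of_mem_primeFactors p.2, P,
    ((Pi.evalMonoidHom _ P).comp (Pi.evalMonoidHom _ p)).comp e.symm.toMonoidHom, ?_, _, _, hP⟩
  exact ((Function.surjective_eval P).comp (Function.surjective_eval p)).comp e.symm.surjective

theorem mainTheorem3 (G : Type*) [Group G] [Finite G] :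
    (∀ (K : Subgroup G) [K.Normal], Maximal HasNonabelianQuotient K →
      (∃ p : ℕ, p.Prime ∧ IsPGroup p (G ⧸ K)) →
        ConnectedSpace (PrimeDivisorSpace G) ∧
          ∀ x : PrimeDivisorSpace G, Subsingleton (FundamentalGroup (PrimeDivisorSpace G) x)) ∧
    ((∃ a b : G, a * b ≠ b * a) → Group.IsNilpotent G →
        ConnectedSpace (PrimeDivisorSpace G) ∧
          ∀ x : PrimeDivisorSpace G, Subsingleton (FundamentalGroup (PrimeDivisorSpace G) x)) := by
  refine ⟨fun K _ hK ⟨p, hp, hP⟩ => ?_, fun h hG => ?_⟩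
  · obtain ⟨_, hab⟩ := hK.prop
    have := contractibleSpace_primeDivisorSpace hp hP hab (QuotientGroup.mk'_surjective K)
    exact ⟨inferInstance, inferInstance⟩
  · obtain ⟨p, hp, P, π, hπ, hab⟩ := hG.exists_surjective_sylow h
    have := contractibleSpace_primeDivisorSpace hp P.2 hab hπ
    exact ⟨inferInstance, inferInstance⟩
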